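/- Consider a line network with nodes $N^{(1)},\dots,N^{(\ell+1)}$ and erasure links $L^{(i)}$ from $N^{(i)}$ to $N^{(i+1)}$, $1\le i\le\ell$, $\ell\ge 1$. In each time step $N^{(i)}$ sends one packet over $L^{(i)}$; it is received (and available at $N^{(i+1)}$ from the next step on) with probability $1-p_i$ and erased with probability $p_i$, independently over links and time steps, where $0\le p_i<1$. Initially the source $N^{(1)}$ holds $n$ linearly independent packets and the other nodes hold none. All nodes store what they receive and use (idealized) linear network coding: every packet sent by $N^{(i)}$ is a linear combination of the packets stored at $N^{(i)}$ and, almost surely, lies outside the span of the packets stored at $N^{(i+1)}$ whenever $N^{(i)}$ stores a packet outside that span. Let $R_t$ be the number of linearly independent packets at the destination $N^{(\ell+1)}$ after $t$ time steps, let $T_n=\min\{t: R_t=n\}$ be the delivery time, and let $A=1-\max_{1\le i\le\ell}p_i$. Then $T_n$ is almost surely finite and integrable, and for every $\delta\in(0,1/2)$ there is an $N$, depending only on $\ell,p_1,\dots,p_\ell,\delta$, such that for all $n\ge N$ $$\mathbb P\left(|T_n-\mathbb E T_n|>\frac{n^{1/2+\delta}}{A}\right)\le\frac{2A}{n}+\frac{2A\,n^{2\delta}}{n^2-n^{1+2\delta}}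 .$$ -/

import Mathlib

open MeasureTheory ProbabilityTheory

/-!
A line network with nodes `0, 1, …, ℓ` (source `0`, destination `ℓ`).  Link `i : Fin ℓ` goes from
node `i.castSucc` to node `i.succ`.  Time steps are numbered `0, 1, 2, …`, so that "after `t` steps"
refers to the steps `s < t`.  Packets are elements of `Fin n → K` for a field `K`: a packet is
identified with its vector of coefficients with respect to the `n` packets at the source.
-/
namespace LineNetwork

/-- The packets held by a node after `t` steps, when `z s i` says whether link `i` is ON at step `s`
and `x s i` is the packet sent on link `i` at step `s`.  The source holds the `n` initial packets;
node `i.succ` holds what was sent on link `i` at the steps at which this link was ON. -/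
def stored {ℓ n : ℕ} {K : Type*} [Field K] (z : ℕ → Fin ℓ → Bool) (x : ℕ → Fin ℓ → Fin n → K)
    (t : ℕ) (v : Fin (ℓ + 1)) : Set (Fin n → K) :=
  Fin.cases (Set.range fun j : Fin n => (Pi.single j (1 : K) : Fin n → K))
    (fun i : Fin ℓ => {y | ∃ s < t, z s i = true ∧ y = x s i}) v

/-- The space spanned by the packets held by a node after `t` steps. -/
def nodeSpace {ℓ n : ℕ} {K : Type*} [Field K] (z : ℕ → Fin ℓ → Bool) (x : ℕ → Fin ℓ → Fin n → K)
    (t : ℕ) (v : Fin (ℓ + 1)) : Submodule K (Fin n → K) :=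
  Submodule.span K (stored z x t v)

/-- Idealized linear network coding.  Every node always sends a linear combination of the packets
that it holds, and this combination is innovative for the next node (it lies outside the space
spanned by the packets held there) whenever the sending node holds any innovative packet. -/
structure IsCoding {ℓ n : ℕ} {K : Type*} [Field K] (z : ℕ → Fin ℓ → Bool)
    (x : ℕ → Fin ℓ → Fin n → K) : Prop where
  linear_combination : ∀ t i, x t i ∈ nodeSpace z x t i.castSucc
  innovative : ∀ t i, (∃ y ∈ stored z x t i.castSucc, y ∉ nodeSpace z x t i.succ) →
    x t i ∉ nodeSpace z x t i.succ

/-- The number `R_t` of linearly independent packets at the destination after `t` steps. -/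
noncomputable def receivedRank {ℓ n : ℕ} {K : Type*} [Field K] (z : ℕ → Fin ℓ → Bool)
    (x : ℕ → Fin ℓ → Fin n → K) (t : ℕ) : ℕ :=
  Module.finrank K (nodeSpace z x t (Fin.last ℓ))

/-- The delivery time `T_n`: the first `t` with `R_t = n`. -/
noncomputable def deliveryTime {ℓ n : ℕ} {K : Type*} [Field K] (z : ℕ → Fin ℓ → Bool)
    (x : ℕ → Fin ℓ → Fin n → K) : ℕ :=
  sInf {t | receivedRank z x t = n}

/-- The random states of the links: independent over links and time steps, link `i` being ON
(`true`) with probability `1 - p i` at each step. -/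
structure IsErasureProcess {ℓ : ℕ} {Ω : Type*} [MeasurableSpace Ω] (μ : Measure Ω)
    (p : Fin ℓ → ℝ) (z : ℕ → Fin ℓ → Ω → Bool) : Prop where
  measurable : ∀ t i, Measurable (z t i)
  indep : iIndepFun (fun (k : ℕ × Fin ℓ) => z k.1 k.2) μ
  prob_on : ∀ t i, μ.real {ω | z t i ω = true} = 1 - p i

/-- The capacity `A = 1 - max_i p_i` of the network. -/
noncomputable def capacity {ℓ : ℕ} (p : Fin ℓ → ℝ) : ℝ := 1 - ⨆ i, p i

end LineNetwork

/-! Innovative coding nests the node spaces along the line, so their dimensions obey a recursion in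
the link states alone (`IsCoding.finrank_nodeSpace`), and `T_n` is a first-exit time of a decreasing
sequence of events.

The bottleneck link gives one tail: delivery by time `t` needs `n` ON steps there, unlikely when `A
t` is well below `n`. For the other, if every link is ON at rate nearly `A` on every interval, each
hop costs only a bounded extra lag (`lineRank_lower_bound`). Hoeffding and a union bound over links
and intervals then make non-delivery unlikely when `A t` is well above `n`
(`IsErasureProcess.prob_undelivered_le`).

The mean is the sum of the tail probabilities. Past `n / A + n^(1/2+δ) / (4A)` they are dominated by
a summable sequence independent of `n`, so the mean lies within that window up to a constant, and
the two tails bound the deviation (`exists_concentration_of_deliveryTail`). They already give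
`2A/n`; the second term of the stated bound is slack. -/

namespace LineNetwork

/-! ### Rank dynamics for fixed link states -/

section Deterministic

/-- The number of linearly independent packets at a node after `t` steps, as a function of the link
states: a link that is ON carries one innovative packet as long as its tail is ahead of its head. -/
def lineRank {ℓ : ℕ} (n : ℕ) (z : ℕ → Fin ℓ → Bool) : ℕ → Fin (ℓ + 1) → ℕ
  | 0 => Fin.cases n fun _ => 0
  | t + 1 => Fin.cases n fun i => lineRank n z t i.succ +
      if z t i = true ∧ lineRank n z t i.succ < lineRank n z t i.castSucc then 1 else 0

/-- The number of steps in `[a, b)` at which link `i` is ON. -/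
noncomputable def onCount {ℓ : ℕ} (z : ℕ → Fin ℓ → Bool) (i : Fin ℓ) (a b : ℕ) : ℝ :=
  ∑ s ∈ Finset.Ico a b, if z s i = true then 1 else 0

variable {ℓ n : ℕ} (z : ℕ → Fin ℓ → Bool)

@[simp] lemma lineRank_source (t : ℕ) : lineRank n z t 0 = n := by cases t <;> rfl

@[simp] lemma lineRank_zero_succ (i : Fin ℓ) : lineRank n z 0 i.succ = 0 := rfl

lemma lineRank_succ_succ (t : ℕ) (i : Fin ℓ) :
    lineRank n z (t + 1) i.succ = lineRank n z t i.succ +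
      if z t i = true ∧ lineRank n z t i.succ < lineRank n z t i.castSucc then 1 else 0 := rfl

lemma lineRank_le_succ (t : ℕ) (v : Fin (ℓ + 1)) : lineRank n z t v ≤ lineRank n z (t + 1) v := by
  cases v using Fin.cases with
  | zero => simp
  | succ i => rw [lineRank_succ_succ]; omega

lemma lineRank_mono (v : Fin (ℓ + 1)) : Monotone fun t => lineRank n z t v :=
  monotone_nat_of_le_succ fun t => lineRank_le_succ z t v

lemma lineRank_succ_le_castSucc (t : ℕ) (i : Fin ℓ) :
    lineRank n z t i.succ ≤ lineRank n z t i.castSucc := by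
  induction t with
  | zero => simp
  | succ t ih =>
    refine le_trans ?_ (lineRank_le_succ z t _)
    rw [lineRank_succ_succ]
    split_ifs with h
    · exact h.2
    · simpa using ih

lemma lineRank_antitone (t : ℕ) : Antitone (lineRank n z t) :=
  Fin.antitone_iff_succ_le.2 (lineRank_succ_le_castSucc z t)

lemma lineRank_le (t : ℕ) (v : Fin (ℓ + 1)) : lineRank n z t v ≤ n := by
  simpa using lineRank_antitone (n := n) z t (Fin.zero_le v)

lemma onCount_self (i : Fin ℓ) (a : ℕ) : onCount z i a a = 0 := by simp [onCount]

lemma onCount_succ (i : Fin ℓ) {a b : ℕ} (h : a ≤ b) :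
    onCount z i a (b + 1) = onCount z i a b + if z b i = true then 1 else 0 := by
  rw [onCount, Finset.sum_Ico_succ_top h, onCount]

lemma lineRank_le_onCount (t : ℕ) (i : Fin ℓ) :
    (lineRank n z t i.succ : ℝ) ≤ onCount z i 0 t := by
  induction t with
  | zero => simp [onCount]
  | succ t ih =>
    rw [lineRank_succ_succ, onCount_succ z i (Nat.zero_le t)]
    push_cast
    split_ifs <;> simp_all
    linarith

/-- If every link is ON at rate at least `A` up to an error `D` in every interval, then a node lags
behind the rate `A` by at most `D + 1` more than its predecessor. -/
lemma lineRank_lower_bound {A D : ℝ} (hA1 : A ≤ 1) {t : ℕ}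
    (h : ∀ i, ∀ a b, a ≤ b → b ≤ t → A * (b - a) - D ≤ onCount z i a b) (v : Fin (ℓ + 1)) :
    ∀ b ≤ t, n ≤ lineRank n z b v ∨ A * b - (v : ℕ) * (D + 1) ≤ lineRank n z b v := by
  induction v using Fin.induction with
  | zero => intro b _; left; simp
  | succ i ih =>
    -- `a` is the step just after the node last had nothing to gain from its predecessor, or `0`;
    -- since then every ON step has raised its rank. The `-1` pays for the restart at `b + 1`
    -- instead of `b`, since `A ≤ 1`.
    have key : ∀ b ≤ t, n ≤ lineRank n z b i.succ ∨ ∃ a ≤ b,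
        A * a - (i : ℕ) * (D + 1) - 1 + onCount z i a b ≤ lineRank n z b i.succ := by
      intro b
      induction b with
      | zero =>
        intro _
        have hD : 0 ≤ D := by simpa [onCount] using h i 0 0 le_rfl (Nat.zero_le t)
        have : (0 : ℝ) ≤ (i : ℕ) * (D + 1) := by positivity
        refine Or.inr ⟨0, le_rfl, ?_⟩
        simp [onCount]
        linarith
      | succ b ihb =>
        intro hb
        rcases ihb (by omega) with h1 | ⟨a, hab, h1⟩
        · exact Or.inl (h1.trans (lineRank_le_succ z b _))
        by_cases hlt : lineRank n z b i.succ < lineRank n z b i.castSucc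
        · refine Or.inr ⟨a, by omega, ?_⟩
          rw [onCount_succ z i hab, lineRank_succ_succ]
          simp only [hlt, and_true]
          push_cast
          linarith
        · rcases ih b (by omega) with h2 | h2
          · exact Or.inl (by have := lineRank_le_succ (n := n) z b i.succ; omega)
          · refine Or.inr ⟨b + 1, le_rfl, ?_⟩
            rw [onCount_self]
            have h3 : (lineRank n z b i.castSucc : ℝ) ≤ lineRank n z (b + 1) i.succ := by
              exact_mod_cast (not_lt.1 hlt).trans (lineRank_le_succ z b _)
            simp only [Fin.val_castSucc] at h2
            push_cast
            linarith
    intro b hb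
    rcases key b hb with h1 | ⟨a, hab, h1⟩
    · exact Or.inl h1
    · right
      have := h i a b hab hb
      rw [Fin.val_succ]
      push_cast
      linarith

end Deterministic

/-! ### From coding to the rank recursion -/

section Coding

variable {ℓ n : ℕ} {K : Type*} [Field K] {z : ℕ → Fin ℓ → Bool} {x : ℕ → Fin ℓ → Fin n → K}

lemma nodeSpace_source (t : ℕ) : nodeSpace z x t 0 = ⊤ := by
  have := (Pi.basisFun K (Fin n)).span_eq
  rw [← this, nodeSpace]
  congr 1
  ext y
  simp [stored, Pi.basisFun_apply]

lemma nodeSpace_zero_succ (i : Fin ℓ) : nodeSpace z x 0 i.succ = ⊥ := by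
  simp [nodeSpace, stored]

lemma nodeSpace_succ_succ (t : ℕ) (i : Fin ℓ) : nodeSpace z x (t + 1) i.succ =
    nodeSpace z x t i.succ ⊔ if z t i = true then K ∙ x t i else ⊥ := by
  have : stored z x (t + 1) i.succ =
      stored z x t i.succ ∪ if z t i = true then {x t i} else ∅ := by
    ext y
    simp only [stored, Fin.cases_succ, Set.mem_ofPred_eq, Set.mem_union]
    constructor
    · rintro ⟨s, hs, hz, rfl⟩
      rcases Nat.lt_succ_iff_lt_or_eq.1 hs with h | rfl
      · exact Or.inl ⟨s, h, hz, rfl⟩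
      · right; simp [hz]
    · rintro (⟨s, hs, hz, rfl⟩ | h)
      · exact ⟨s, by omega, hz, rfl⟩
      · split_ifs at h with hz
        · exact ⟨t, by omega, hz, h⟩
        · exact h.elim
  rw [nodeSpace, this, Submodule.span_union]
  split_ifs <;> simp [nodeSpace]

lemma nodeSpace_mono (v : Fin (ℓ + 1)) : Monotone fun t => nodeSpace z x t v := by
  refine monotone_nat_of_le_succ fun t => ?_
  cases v using Fin.cases with
  | zero => simp [nodeSpace_source]
  | succ i => rw [nodeSpace_succ_succ]; exact le_sup_left

lemma IsCoding.nodeSpace_succ_le (h : IsCoding z x) (t : ℕ) (i : Fin ℓ) :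
    nodeSpace z x t i.succ ≤ nodeSpace z x t i.castSucc := by
  induction t with
  | zero => simp [nodeSpace_zero_succ]
  | succ t ih =>
    refine le_trans ?_ (nodeSpace_mono (x := x) _ (Nat.le_succ t))
    rw [nodeSpace_succ_succ]
    refine sup_le ih ?_
    split_ifs
    · simpa using h.linear_combination t i
    · exact bot_le

/-- Since the spaces are nested, a strictly larger dimension at the tail forces an innovative packet
there, and equal dimensions force equal spaces. The field and the choice of code thus drop out. -/
lemma IsCoding.finrank_nodeSpace (h : IsCoding z x) (t : ℕ) (v : Fin (ℓ + 1)) :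
    Module.finrank K (nodeSpace z x t v) = lineRank n z t v := by
  induction t generalizing v with
  | zero =>
    cases v using Fin.cases with
    | zero => rw [nodeSpace_source]; simp
    | succ i => rw [nodeSpace_zero_succ]; simp
  | succ t ih =>
    cases v using Fin.cases with
    | zero => rw [nodeSpace_source]; simp
    | succ i =>
      rw [nodeSpace_succ_succ, lineRank_succ_succ]
      by_cases hz : z t i = true
      · by_cases hlt : lineRank n z t i.succ < lineRank n z t i.castSucc
        · have hx : x t i ∉ nodeSpace z x t i.succ := by
            refine h.innovative t i ?_
            by_contra! hcon
            have : nodeSpace z x t i.castSucc ≤ nodeSpace z x t i.succ := Submodule.span_le.2 hcon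
            have := Submodule.finrank_mono this
            rw [ih, ih] at this
            omega
          rw [if_pos (And.intro hz hlt), if_pos hz, Submodule.finrank_sup_span_singleton hx, ih]
        · have heq : nodeSpace z x t i.succ = nodeSpace z x t i.castSucc :=
            Submodule.eq_of_le_of_finrank_le (h.nodeSpace_succ_le t i) (by rw [ih, ih]; omega)
          have hx : K ∙ x t i ≤ nodeSpace z x t i.succ := by
            rw [heq]; simpa using h.linear_combination t i
          simp only [hlt, and_false, if_false, add_zero]
          rw [if_pos hz, sup_eq_left.2 hx, ih]
      · rw [if_neg hz, if_neg (fun h => hz h.1), sup_bot_eq, add_zero, ih]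

lemma IsCoding.receivedRank_eq (h : IsCoding z x) (t : ℕ) :
    receivedRank z x t = lineRank n z t (Fin.last ℓ) :=
  h.finrank_nodeSpace t _

end Coding

end LineNetwork

namespace LineNetwork

/-! ### Tail probabilities of the delivery time -/

section Probability

/-- The event that fewer than `n` packets have been delivered after `t` steps. -/
def undelivered {ℓ : ℕ} {Ω : Type*} (z : ℕ → Fin ℓ → Ω → Bool) (n t : ℕ) : Set Ω :=
  {ω | lineRank n (fun t i => z t i ω) t (Fin.last ℓ) < n}

lemma undelivered_antitone {ℓ : ℕ} {Ω : Type*} (z : ℕ → Fin ℓ → Ω → Bool) (n : ℕ) : Antitone (undelivered z n) := fun _ _ hst ω hω =>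
  lt_of_le_of_lt (lineRank_mono (fun t i => z t i ω) (Fin.last ℓ) hst) hω

variable {ℓ : ℕ} {Ω : Type*} [MeasurableSpace Ω] {μ : Measure Ω} {p : Fin ℓ → ℝ}
  {z : ℕ → Fin ℓ → Ω → Bool}

lemma measurable_ite_eq_true {f : Ω → Bool} (hf : Measurable f) :
    Measurable fun ω => if f ω = true then (1 : ℝ) else 0 :=
  (measurable_from_top (f := fun b : Bool => if b = true then (1 : ℝ) else 0)).comp hf

lemma IsErasureProcess.iIndepFun_centered (hz : IsErasureProcess μ p z) (i : Fin ℓ) (r : ℝ) :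
    iIndepFun (fun s ω => r * ((if z s i ω = true then (1 : ℝ) else 0) - (1 - p i))) μ := by
  have h1 : iIndepFun (fun s => z s i) μ :=
    hz.indep.precomp (g := fun s : ℕ => (s, i)) fun a b h => by simpa using h
  exact h1.comp (fun _ b => r * ((if b = true then (1 : ℝ) else 0) - (1 - p i)))
    fun _ => measurable_from_top

lemma measurable_lineRank (n : ℕ) (hz : ∀ t i, Measurable (z t i)) (t : ℕ) (v : Fin (ℓ + 1)) :
    Measurable fun ω => lineRank n (fun t i => z t i ω) t v := by
  induction t generalizing v with
  | zero => cases v using Fin.cases <;> simp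
  | succ t ih =>
    cases v using Fin.cases with
    | zero => simp
    | succ i =>
      simp only [lineRank_succ_succ]
      refine (ih _).add (Measurable.ite ?_ measurable_const measurable_const)
      exact (hz t i (MeasurableSet.singleton true)).inter
        (measurableSet_lt (ih _) (ih _))

lemma IsErasureProcess.measurableSet_undelivered (hz : IsErasureProcess μ p z) (n t : ℕ) :
    MeasurableSet (undelivered z n t) :=
  measurableSet_lt (measurable_lineRank n hz.measurable t _) measurable_const

lemma IsErasureProcess.integral_ite (hz : IsErasureProcess μ p z) (s : ℕ) (i : Fin ℓ) :
    ∫ ω, (if z s i ω = true then (1 : ℝ) else 0) ∂μ = 1 - p i := by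
  rw [← hz.prob_on s i, ← integral_indicator_one
    (show MeasurableSet {ω | z s i ω = true} from hz.measurable s i (MeasurableSet.singleton true))]
  congr 1
  ext ω
  simp [Set.indicator_apply]

variable [IsProbabilityMeasure μ]

lemma IsErasureProcess.hasSubgaussianMGF_centered (hz : IsErasureProcess μ p z) (s : ℕ)
    (i : Fin ℓ) : HasSubgaussianMGF
      (fun ω => (if z s i ω = true then (1 : ℝ) else 0) - (1 - p i)) (1 / 4) μ := by
  have := hasSubgaussianMGF_of_mem_Icc (μ := μ) (a := 0) (b := 1)
    (measurable_ite_eq_true (hz.measurable s i)).aemeasurable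
    (Filter.Eventually.of_forall fun ω => by split_ifs <;> simp)
  rw [hz.integral_ite] at this
  convert this using 1
  ext
  norm_num

/-- The sign `r = ±1` lets one statement serve both tails. -/
lemma IsErasureProcess.hoeffding (hz : IsErasureProcess μ p z) (i : Fin ℓ) {r : ℝ}
    (hr : r ^ 2 = 1) {D : ℝ} (hD : 0 ≤ D) {a b : ℕ} (hab : a ≤ b) :
    μ.real {ω | D ≤ r * (onCount (fun t i => z t i ω) i a b - (1 - p i) * (b - a))} ≤
      Real.exp (-2 * D ^ 2 / (b - a)) := by
  have := HasSubgaussianMGF.measure_sum_ge_le_of_iIndepFun (hz.iIndepFun_centered i r)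
    (s := Finset.Ico a b) (c := fun _ => 1 / 4) (ε := D) (fun s _ => by
      convert (hz.hasSubgaussianMGF_centered s i).const_mul r using 1
      ext
      change (1 / 4 : ℝ) = r ^ 2 * (1 / 4)
      rw [hr, one_mul]) hD
  convert this using 2
  · ext ω
    simp only [Set.mem_ofPred_eq, ← Finset.mul_sum, onCount]
    rw [Finset.sum_sub_distrib, Finset.sum_const, Nat.card_Ico, nsmul_eq_mul, Nat.cast_sub hab, mul_comm (1 - p i)]
  · simp only [Finset.sum_const, Nat.card_Ico, nsmul_eq_mul, NNReal.coe_mul,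
      NNReal.coe_natCast, Nat.cast_sub hab]
    push_cast
    rw [show (2 : ℝ) * ((b - a) * (1 / 4)) = (b - a) / 2 by ring]
    rw [div_div_eq_mul_div]
    ring

lemma IsErasureProcess.prob_undelivered_le (hz : IsErasureProcess μ p z) {A : ℝ} (hA1 : A ≤ 1)
    (hA : ∀ i, A ≤ 1 - p i) (hℓ : 1 ≤ ℓ) {n t : ℕ} (ht : 2 * ℓ ≤ A * t - n) :
    μ.real (undelivered z n t) ≤
      ℓ * (t + 1) ^ 2 * Real.exp (-(A * t - n) ^ 2 / (2 * ℓ ^ 2 * t)) := by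
  have hℓ0 : (0 : ℝ) < ℓ := by exact_mod_cast hℓ
  -- Chosen so that the total lag `ℓ * (D + 1)` is exactly `A * t - n`; `ht` makes `D` at least half
  -- of `(A * t - n) / ℓ`.
  set D : ℝ := (A * t - n) / ℓ - 1 with hD
  have hD2 : 2 ≤ (A * t - n) / ℓ := by rw [le_div_iff₀ hℓ0]; exact ht
  have hD1 : 1 ≤ D := by linarith
  have hDhalf : (A * t - n) / ℓ / 2 ≤ D := by linarith
  let I : Finset (Fin ℓ × ℕ × ℕ) :=
    Finset.univ ×ˢ ((Finset.range (t + 1)) ×ˢ (Finset.range (t + 1)))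
  -- Empty intervals are excluded: there the Hoeffding exponent divides by zero and the bound
  -- degenerates to `1`.
  let bad : Fin ℓ × ℕ × ℕ → Set Ω := fun k => {ω | k.2.1 < k.2.2 ∧
    D ≤ (-1) * (onCount (fun t i => z t i ω) k.1 k.2.1 k.2.2 - (1 - p k.1) * (k.2.2 - k.2.1))}
  have hsub : undelivered z n t ⊆ ⋃ k ∈ I, bad k := by
    intro ω hω
    by_contra hcon
    simp only [Set.mem_iUnion, not_exists] at hcon
    have hlow := lineRank_lower_bound (n := n) (fun t i => z t i ω) (A := A) (D := D) hA1 (t := t)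
      (fun i a b hab hb => by
        rcases hab.eq_or_lt with rfl | hlt
        · rw [onCount_self]; linarith
        · have h1 := hcon (i, a, b) (by simp [I]; omega)
          simp only [bad, Set.mem_ofPred_eq, hlt, true_and, not_le] at h1
          have h2 : A * ((b : ℝ) - a) ≤ (1 - p i) * (b - a) :=
            mul_le_mul_of_nonneg_right (hA i) (by rw [sub_nonneg]; exact_mod_cast hab)
          linarith) (Fin.last ℓ) t le_rfl
    have hω' : lineRank n (fun t i => z t i ω) t (Fin.last ℓ) < n := hω
    rcases hlow with h | h
    · omega
    · have h3 : ((Fin.last ℓ : Fin (ℓ + 1)) : ℕ) * (D + 1) = A * t - n := by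
        rw [hD, Fin.val_last]; field_simp; ring
      rw [h3] at h
      have : (n : ℝ) ≤ lineRank n (fun t i => z t i ω) t (Fin.last ℓ) := by linarith
      exact absurd (by exact_mod_cast this) (not_le.2 hω')
  have hbad : ∀ k ∈ I, μ.real (bad k) ≤ Real.exp (-(A * t - n) ^ 2 / (2 * ℓ ^ 2 * t)) := by
    rintro ⟨i, a, b⟩ hk
    have hb : b ≤ t := by simp [I] at hk; omega
    by_cases hlt : a < b
    · refine (measureReal_mono (fun ω hω => hω.2)).trans
        ((hz.hoeffding i (r := -1) (by norm_num) (by linarith) hlt.le).trans ?_)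
      rw [Real.exp_le_exp]
      have hba : (0 : ℝ) < b - a := by rw [sub_pos]; exact_mod_cast hlt
      have hbt : (b : ℝ) - a ≤ t := by
        have : (b : ℝ) ≤ t := by exact_mod_cast hb
        have : (0 : ℝ) ≤ a := by positivity
        linarith
      have hsq : ((A * t - n) / ℓ / 2) ^ 2 ≤ D ^ 2 := by
        apply pow_le_pow_left₀ _ hDhalf; linarith
      calc -2 * D ^ 2 / ((b : ℝ) - a) = -(2 * D ^ 2 / (b - a)) := by ring
        _ ≤ -(2 * ((A * t - n) / ℓ / 2) ^ 2 / t) := by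
          apply neg_le_neg
          apply div_le_div₀ (by positivity) (by linarith) hba hbt
        _ = _ := by field_simp
    · have : bad (i, a, b) = ∅ := by
        ext ω; simp [bad, hlt]
      rw [this]; simp; positivity
  calc μ.real (undelivered z n t) ≤ μ.real (⋃ k ∈ I, bad k) := 
      measureReal_mono hsub (measure_ne_top _ _)
    _ ≤ ∑ k ∈ I, μ.real (bad k) := measureReal_biUnion_finset_le _ _
    _ ≤ ∑ k ∈ I, Real.exp (-(A * t - n) ^ 2 / (2 * ℓ ^ 2 * t)) := Finset.sum_le_sum hbad
    _ = _ := by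
      rw [Finset.sum_const, nsmul_eq_mul]
      simp only [I, Finset.card_product, Finset.card_univ, Fintype.card_fin, Finset.card_range]
      push_cast
      ring

/-- All `n` dimensions must cross link `j`, each at a separate ON step. -/
lemma IsErasureProcess.one_sub_prob_undelivered_le (hz : IsErasureProcess μ p z) (j : Fin ℓ)
    {n t : ℕ} (ht : (1 - p j) * t ≤ n) :
    1 - μ.real (undelivered z n t) ≤ Real.exp (-2 * (n - (1 - p j) * t) ^ 2 / t) := by
  rw [← probReal_compl_eq_one_sub (hz.measurableSet_undelivered n t)]
  have h := hz.hoeffding j (r := 1) (by norm_num) (sub_nonneg.2 ht) (Nat.zero_le t)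
  simp only [Nat.cast_zero, sub_zero, one_mul] at h
  refine (measureReal_mono fun ω hω => ?_).trans h
  have h1 : n ≤ lineRank n (fun t i => z t i ω) t (Fin.last ℓ) := not_lt.1 hω
  have h2 := h1.trans (lineRank_antitone (n := n) (fun t i => z t i ω) t (Fin.le_last j.succ))
  have h3 := lineRank_le_onCount (n := n) (fun t i => z t i ω) t j
  have h4 : (n : ℝ) ≤ lineRank n (fun t i => z t i ω) t j.succ := by exact_mod_cast h2
  simp only [Set.mem_ofPred_eq]
  linarith

end Probability

end LineNetwork

/-! ### Mean of a first-exit time -/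

section ExitTime

/-- The first exit time from a decreasing sequence of events with summable probabilities is almost
surely finite, integrable, and its mean is the sum of the probabilities. -/
lemma integrable_and_integral_firstExit {Ω : Type*} [MeasurableSpace Ω] {μ : Measure Ω}
    [IsFiniteMeasure μ] {E : ℕ → Set Ω} (hE : ∀ t, MeasurableSet (E t)) (hanti : Antitone E)
    (hs : Summable fun t => μ.real (E t)) {T : Ω → ℝ}
    (hT : ∀ᵐ ω ∂μ, T ω = (sInf {t | ω ∉ E t} : ℕ)) :
    (∀ᵐ ω ∂μ, ∃ t, ω ∉ E t) ∧ Integrable T μ ∧ ∫ ω, T ω ∂μ = ∑' t, μ.real (E t) := by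
  -- `Y` counts the events containing `ω`; as they decrease, this is the exit time wherever that is
  -- finite. Elsewhere `Y = ⊤` whereas `sInf ∅ = 0`, so `hex` is needed first.
  let Y : Ω → ENNReal := fun ω => ∑' t, (E t).indicator 1 ω
  have hY : Measurable Y := Measurable.tsum fun t => measurable_one.indicator (hE t)
  have hint : ∫⁻ ω, Y ω ∂μ = ENNReal.ofReal (∑' t, μ.real (E t)) := by
    rw [lintegral_tsum fun t => (measurable_one.indicator (hE t)).aemeasurable,
      ENNReal.ofReal_tsum_of_nonneg (fun _ => measureReal_nonneg) hs]
    congr 1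
    ext t
    rw [lintegral_indicator_one (hE t), ofReal_measureReal]
  have hfin : ∫⁻ ω, Y ω ∂μ ≠ ⊤ := by rw [hint]; exact ENNReal.ofReal_ne_top
  have hex : ∀ᵐ ω ∂μ, ∃ t, ω ∉ E t := by
    filter_upwards [ae_lt_top hY hfin] with ω hω
    by_contra! hcon
    have : Y ω = ⊤ := by simp [Y, hcon]
    exact hω.ne this
  have hTY : T =ᵐ[μ] fun ω => (Y ω).toReal := by
    filter_upwards [hT, hex] with ω h1 h2
    have hmem : ∀ t, ω ∈ E t ↔ t < sInf {t | ω ∉ E t} := by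
      intro t
      constructor
      · intro ht
        by_contra! hle
        exact Nat.sInf_mem h2 (hanti hle ht)
      · intro ht
        by_contra hn
        exact Nat.notMem_of_lt_sInf ht hn
    have : Y ω = (sInf {t | ω ∉ E t} : ℕ) := by
      change ∑' t, (E t).indicator 1 ω = _
      rw [tsum_eq_sum (s := Finset.range (sInf {t | ω ∉ E t}))]
      · rw [Finset.sum_congr rfl (g := fun _ => 1)]
        · simp
        · intro t ht
          rw [Set.indicator_of_mem ((hmem t).2 (Finset.mem_range.1 ht)), Pi.one_apply]
      · intro t ht
        exact Set.indicator_of_notMem (fun h => ht (Finset.mem_range.2 ((hmem t).1 h))) _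
    rw [h1, this, ENNReal.toReal_natCast]
  refine ⟨hex, (integrable_toReal_of_lintegral_ne_top hY.aemeasurable hfin).congr hTY.symm, ?_⟩
  rw [integral_congr_ae hTY, integral_toReal hY.aemeasurable (ae_lt_top hY hfin), hint,
    ENNReal.toReal_ofReal (tsum_nonneg fun _ => measureReal_nonneg)]

end ExitTime

/-! ### Concentration from stretched-exponential tails -/

section Analysis

open Filter Topology

lemma tendsto_rpow_mul_exp_neg_rpow {a c : ℝ} (ha : 0 < a) (hc : 0 < c) (k : ℝ) :
    Tendsto (fun t : ℝ => t ^ k * Real.exp (-c * t ^ a)) atTop (𝓝 0) := by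
  refine ((tendsto_rpow_mul_exp_neg_mul_atTop_nhds_zero (k / a) c hc).comp
    (tendsto_rpow_atTop ha)).congr' ?_
  filter_upwards [eventually_ge_atTop 0] with t ht
  simp only [Function.comp]
  rw [← Real.rpow_mul ht, mul_div_cancel₀ _ ha.ne']

lemma eventually_natCast_mul_exp_neg_rpow_le {a c ε : ℝ} (ha : 0 < a) (hc : 0 < c) (hε : 0 < ε)
    (k : ℕ) : ∀ᶠ t : ℕ in atTop, (t : ℝ) ^ k * Real.exp (-c * (t : ℝ) ^ a) ≤ ε := by
  have := (tendsto_rpow_mul_exp_neg_rpow ha hc k).comp tendsto_natCast_atTop_atTop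
  filter_upwards [this.eventually_le_const hε] with t ht
  simpa using ht

lemma summable_sq_mul_exp_neg_rpow {a c : ℝ} (ha : 0 < a) (hc : 0 < c) (L : ℝ) :
    Summable fun t : ℕ => L * ((t : ℝ) + 1) ^ 2 * Real.exp (-c * (t : ℝ) ^ a) := by
  simp_rw [mul_assoc]
  refine Summable.mul_left L ?_
  refine Summable.of_norm_bounded_eventually_nat
    ((Real.summable_nat_pow_inv.2 one_lt_two).mul_left 4) ?_
  filter_upwards [eventually_natCast_mul_exp_neg_rpow_le ha hc one_pos 4, eventually_ge_atTop 1]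
    with t h1 h2
  have ht : (1 : ℝ) ≤ t := by exact_mod_cast h2
  rw [Real.norm_of_nonneg (by positivity), ← div_eq_mul_inv, le_div_iff₀ (by positivity)]
  calc ((t : ℝ) + 1) ^ 2 * Real.exp (-c * (t : ℝ) ^ a) * t ^ 2
      ≤ (2 * t) ^ 2 * Real.exp (-c * (t : ℝ) ^ a) * t ^ 2 := by gcongr; linarith
    _ = 4 * (t ^ 4 * Real.exp (-c * (t : ℝ) ^ a)) := by ring
    _ ≤ 4 := by linarith

lemma sq_rpow_half_add {n : ℝ} (hn : 0 < n) (δ : ℝ) :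
    (n ^ (1 / 2 + δ)) ^ 2 = n * n ^ (2 * δ) := by
  rw [← Real.rpow_natCast, ← Real.rpow_mul hn.le]
  nth_rw 2 [← Real.rpow_one n]
  rw [← Real.rpow_add hn]
  congr 1
  push_cast
  ring

/-- The two regimes `A t ≤ 2 n` and `A t ≥ 2 n` give one stretched exponential tail. -/
lemma mul_rpow_le_sq_div {L A δ : ℝ} (hL : 0 < L) (hA0 : 0 < A) (hA1 : A ≤ 1) (hδ0 : 0 < δ)
    (hδ1 : δ < 1 / 2) {n t : ℝ} (hn : 0 < n) (ht : 1 ≤ t)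
    (h : 2 * n ≤ A * t ∨ n ^ (1 / 2 + δ) / 4 ≤ A * t - n) :
    A ^ 2 / (128 * L ^ 2) * t ^ (2 * δ) ≤ (A * t - n) ^ 2 / (2 * L ^ 2 * t) := by
  have ht0 : 0 < t := by linarith
  rw [le_div_iff₀ (by positivity)]
  have htδ : t ^ (2 * δ) ≤ t := by
    simpa using Real.rpow_le_rpow_of_exponent_le ht (by linarith : 2 * δ ≤ 1)
  have e1 : A ^ 2 / (128 * L ^ 2) * t ^ (2 * δ) * (2 * L ^ 2 * t) = A ^ 2 * t ^ (2 * δ) * t / 64 := by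
    field_simp; ring
  rw [e1]
  by_cases h2 : 2 * n ≤ A * t
  · have h3 : A * t / 2 ≤ A * t - n := by linarith
    have h4 : (A * t / 2) ^ 2 ≤ (A * t - n) ^ 2 := by
      apply pow_le_pow_left₀ (by positivity) h3
    have h5 : A ^ 2 * t ^ (2 * δ) * t ≤ A ^ 2 * t * t := by gcongr
    nlinarith [sq_nonneg (A * t)]
  -- Here `A t < 2 n`, so `n^(1+2δ) / 16` is at least `(A/2)^2 t^(1+2δ) / 16`; this is the source of
  -- `64`, and of `128` after division by `2 L^2 t`.
  · have h3 := h.resolve_left h2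
    have h4 : (n ^ (1 / 2 + δ) / 4) ^ 2 ≤ (A * t - n) ^ 2 := by
      apply pow_le_pow_left₀ (by positivity) h3
    have h5 := sq_rpow_half_add hn δ
    have h6 : A / 2 * t ≤ n := by linarith
    have h7 : A / 2 ≤ (A / 2) ^ (2 * δ) := by
      simpa using Real.rpow_le_rpow_of_exponent_ge (by positivity) (by linarith)
        (by linarith : 2 * δ ≤ 1)
    have h8 : (A / 2) ^ (2 * δ) * t ^ (2 * δ) ≤ n ^ (2 * δ) := by
      rw [← Real.mul_rpow (by positivity) ht0.le]
      exact Real.rpow_le_rpow (by positivity) h6 (by positivity)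
    have h9 : A / 2 * t ^ (2 * δ) ≤ n ^ (2 * δ) :=
      le_trans (by gcongr) h8
    have h10 : (A / 2 * t) * (A / 2 * t ^ (2 * δ)) ≤ n * n ^ (2 * δ) := by gcongr
    rw [div_pow, h5] at h4
    linarith

/-- Tail bounds for the delivery time of `n` packets over `L` links of capacity at least `A`, with
`q t` the probability of the delivery time exceeding `t`. -/
structure DeliveryTail (L A : ℝ) (n : ℕ) (q : ℕ → ℝ) : Prop where
  nonneg : ∀ t, 0 ≤ q t
  le_one : ∀ t, q t ≤ 1
  antitone : Antitone q
  upper : ∀ t : ℕ, 2 * L ≤ A * t - n →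
    q t ≤ L * (t + 1) ^ 2 * Real.exp (-(A * t - n) ^ 2 / (2 * L ^ 2 * t))
  lower : ∀ t : ℕ, A * t ≤ n → 1 - q t ≤ Real.exp (-2 * (n - A * t) ^ 2 / t)

/-- The right side is free of `n`: its sum over `t` bounds the late part of the mean uniformly in
`n`. -/
lemma DeliveryTail.le_stretchedExp {L A δ : ℝ} {n : ℕ} {q : ℕ → ℝ} (hq : DeliveryTail L A n q)
    (hL : 0 < L) (hA0 : 0 < A) (hA1 : A ≤ 1) (hδ0 : 0 < δ) (hδ1 : δ < 1 / 2) (hn : 0 < n)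
    {t : ℕ} (ht : 1 ≤ t) (hLt : 2 * L ≤ A * t - n)
    (h : 2 * (n : ℝ) ≤ A * t ∨ (n : ℝ) ^ (1 / 2 + δ) / 4 ≤ A * t - n) :
    q t ≤ L * ((t : ℝ) + 1) ^ 2 * Real.exp (-(A ^ 2 / (128 * L ^ 2)) * (t : ℝ) ^ (2 * δ)) := by
  refine (hq.upper t hLt).trans ?_
  gcongr
  have := mul_rpow_le_sq_div hL hA0 hA1 hδ0 hδ1 (by exact_mod_cast hn : (0 : ℝ) < n)
    (by exact_mod_cast ht) h
  rw [neg_div, neg_mul]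
  exact neg_le_neg this

lemma DeliveryTail.summable {L A : ℝ} {n : ℕ} {q : ℕ → ℝ} (hq : DeliveryTail L A n q)
    (hL : 0 < L) (hA0 : 0 < A) (hA1 : A ≤ 1) (hn : 0 < n) : Summable q := by
  refine Summable.of_norm_bounded_eventually_nat (summable_sq_mul_exp_neg_rpow
    (a := 2 * (1 / 4)) (c := A ^ 2 / (128 * L ^ 2)) (by norm_num) (by positivity) L) ?_
  have h1 : Tendsto (fun t : ℕ => A * (t : ℝ)) atTop atTop :=
    tendsto_natCast_atTop_atTop.const_mul_atTop hA0
  filter_upwards [h1.eventually_ge_atTop (2 * n), h1.eventually_ge_atTop (2 * L + n),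
    eventually_ge_atTop 1] with t h2 h3 h4
  rw [Real.norm_of_nonneg (hq.nonneg t)]
  exact hq.le_stretchedExp hL hA0 hA1 (by norm_num) (by norm_num) hn h4 (by linarith) (Or.inl h2)

lemma DeliveryTail.one_sub_le {L A δ : ℝ} {n : ℕ} {q : ℕ → ℝ} (hq : DeliveryTail L A n q)
    (hn : 0 < n) {t : ℕ} (ht : 1 ≤ t) (h : A * t ≤ n - (n : ℝ) ^ (1 / 2 + δ) / 4) :
    1 - q t ≤ Real.exp (-(A / 8) * (n : ℝ) ^ (2 * δ)) := by
  have hn' : (0 : ℝ) < n := by exact_mod_cast hn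
  have ht' : (0 : ℝ) < t := by exact_mod_cast ht
  have hm : 0 < (n : ℝ) ^ (1 / 2 + δ) / 4 := by positivity
  refine (hq.lower t (by linarith)).trans ?_
  rw [Real.exp_le_exp, div_le_iff₀ ht']
  have h5 := sq_rpow_half_add hn' δ
  have h6 : ((n : ℝ) ^ (1 / 2 + δ) / 4) ^ 2 ≤ (n - A * t) ^ 2 := by
    apply pow_le_pow_left₀ hm.le; linarith
  rw [div_pow, h5] at h6
  have h7 : A * t * (n : ℝ) ^ (2 * δ) ≤ n * (n : ℝ) ^ (2 * δ) := by
    gcongr; linarith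
  linarith

/-- Sequences with the tail bounds of a delivery time concentrate around their sum. -/
lemma exists_concentration_of_deliveryTail {L A δ : ℝ} (hL : 0 < L) (hA0 : 0 < A) (hA1 : A ≤ 1)
    (hδ0 : 0 < δ) (hδ1 : δ < 1 / 2) : ∃ N : ℕ, ∀ n ≥ N, ∀ q : ℕ → ℝ, DeliveryTail L A n q →
      ∃ t₁ t₂ : ℕ, t₁ ≤ ∑' t, q t + (n : ℝ) ^ (1 / 2 + δ) / A ∧
        ∑' t, q t - (n : ℝ) ^ (1 / 2 + δ) / A ≤ t₂ + 1 ∧ q t₁ + (1 - q t₂) ≤ 2 * A / n := by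
  set c : ℝ := A ^ 2 / (128 * L ^ 2) with hc
  have hc0 : 0 < c := by positivity
  let w : ℕ → ℝ := fun t => L * ((t : ℝ) + 1) ^ 2 * Real.exp (-c * (t : ℝ) ^ (2 * δ))
  have hw0 : ∀ t, 0 ≤ w t := fun t => by positivity
  have hws : Summable w := summable_sq_mul_exp_neg_rpow (by positivity) hc0 L
  set C : ℝ := ∑' t, w t with hC
  have hC0 : 0 ≤ C := tsum_nonneg hw0
  have hm : ∀ᶠ n : ℕ in atTop, 4 * (2 * L + C + 3) ≤ (n : ℝ) ^ (1 / 2 + δ) :=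
    ((tendsto_rpow_atTop (by linarith : 0 < 1 / 2 + δ)).comp
      tendsto_natCast_atTop_atTop).eventually_ge_atTop _
  obtain ⟨N₁, hN₁⟩ := eventually_atTop.1
    (eventually_natCast_mul_exp_neg_rpow_le (a := 2 * δ) (by positivity) hc0
      -- The constant and the cube come from `(t₁ + 1)^2 ≤ 4 t₁^2` and `n ≤ t₁` in the bound `q t₁ ≤
      -- A / n`.
      (by positivity : 0 < A / (4 * L)) 3)
  have he := eventually_natCast_mul_exp_neg_rpow_le (a := 2 * δ) (c := A / 8) (by positivity)
    (by positivity) hA0 1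
  obtain ⟨N, hN⟩ := eventually_atTop.1
    (hm.and (he.and ((eventually_ge_atTop 2).and (eventually_ge_atTop N₁))))
  refine ⟨N, fun n hn q hq => ?_⟩
  obtain ⟨hm, he, hn2, hnN⟩ := hN n hn
  have hn0 : 0 < n := by omega
  have hn2' : (2 : ℝ) ≤ n := by exact_mod_cast hn2
  have hnpos : (0 : ℝ) < n := by linarith
  -- The allowed deviation is `4 m / A`. The cutoffs `t₁`, `t₂` and the mean each lie within `m / A`
  -- of `n / A` up to constants, so the remaining `2 m / A` absorbs rounding and `C`.
  set m : ℝ := (n : ℝ) ^ (1 / 2 + δ) / 4 with hmdef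
  have hr : (n : ℝ) ^ (1 / 2 + δ) = 4 * m := by rw [hmdef]; ring
  rw [hr] at hm ⊢
  have hmL : 2 * L + C + 3 ≤ m := by linarith
  have hm0 : 0 < m := by linarith
  have hmA : m ≤ m / A := by rw [le_div_iff₀ hA0]; nlinarith
  have hmn : m ≤ n / 4 := by
    have : (n : ℝ) ^ (1 / 2 + δ) ≤ n := by
      simpa using Real.rpow_le_rpow_of_exponent_le (by linarith : (1 : ℝ) ≤ n)
        (by linarith : 1 / 2 + δ ≤ 1)
    rw [hmdef]; linarith
  set e : ℝ := Real.exp (-(A / 8) * (n : ℝ) ^ (2 * δ)) with hedef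
  have he0 : 0 < e := Real.exp_pos _
  have heA : e ≤ A / n := by rw [le_div_iff₀ hnpos]; linarith
  have he1 : e ≤ 1 := heA.trans (by rw [div_le_one hnpos]; linarith)
  set t₁ : ℕ := ⌈(n + m) / A⌉₊ with ht₁
  set t₂ : ℕ := ⌊(n - m) / A⌋₊ with ht₂
  have ht₁ge : (n + m) / A ≤ t₁ := Nat.le_ceil _
  have ht₁le : (t₁ : ℝ) ≤ (n + m) / A + 1 := (Nat.ceil_lt_add_one (by positivity)).le
  have ht₂le : (t₂ : ℝ) ≤ (n - m) / A := Nat.floor_le (div_nonneg (by linarith) hA0.le)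
  have ht₂ge : (n - m) / A ≤ t₂ + 1 := (Nat.lt_floor_add_one _).le
  have ht₂1 : 1 ≤ t₂ := by
    rw [ht₂, Nat.one_le_floor_iff, le_div_iff₀ hA0]; linarith
  have hnt₁ : (n : ℝ) ≤ t₁ := le_trans (by rw [le_div_iff₀ hA0]; nlinarith) ht₁ge
  have hnt₁' : n ≤ t₁ := by exact_mod_cast hnt₁
  have hqw : ∀ t, t₁ ≤ t → q t ≤ w t := by
    intro t ht
    have ht' : (t₁ : ℝ) ≤ t := by exact_mod_cast ht
    have h1 : n + m ≤ A * t := by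
      have := ht₁ge.trans ht'
      rw [div_le_iff₀ hA0] at this
      linarith
    exact hq.le_stretchedExp hL hA0 hA1 hδ0 hδ1 hn0 (by omega) (by linarith)
      (Or.inr (by linarith))
  have hqs := hq.summable hL hA0 hA1 hn0
  have hq₂ : 1 - q t₂ ≤ e := hq.one_sub_le hn0 ht₂1 (by
    rw [le_div_iff₀ hA0] at ht₂le
    linarith)
  -- The loss `2` bounds `(t₂ + 1) * e`, as `t₂ * e ≤ 1` and `e ≤ 1`.
  have hlow : (n - m) / A - 2 ≤ ∑' t, q t := by
    have h1 : ∑ t ∈ Finset.range (t₂ + 1), q t ≤ ∑' t, q t :=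
      hqs.sum_le_tsum _ fun t _ => hq.nonneg t
    have h2 : ∑ t ∈ Finset.range (t₂ + 1), (1 - e) ≤ ∑ t ∈ Finset.range (t₂ + 1), q t := by
      refine Finset.sum_le_sum fun t ht => ?_
      have := hq.antitone (Nat.lt_succ_iff.1 (Finset.mem_range.1 ht))
      linarith
    rw [Finset.sum_const, Finset.card_range, nsmul_eq_mul] at h2
    push_cast at h2
    have h3 : (t₂ : ℝ) * e ≤ 1 := by
      have h4 : (t₂ : ℝ) ≤ n / A := ht₂le.trans (by gcongr; linarith)
      calc (t₂ : ℝ) * e ≤ n / A * (A / n) := by gcongr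
        _ = 1 := by field_simp
    linarith
  have hup : ∑' t, q t ≤ t₁ + C := by
    rw [← hqs.sum_add_tsum_nat_add t₁]
    have h1 : ∑ t ∈ Finset.range t₁, q t ≤ t₁ := by
      simpa using Finset.sum_le_sum (s := Finset.range t₁) fun t _ => hq.le_one t
    have h2 : ∑' t, q (t + t₁) ≤ ∑' t, w (t + t₁) :=
      ((summable_nat_add_iff t₁).2 hqs).tsum_le_tsum (fun t => hqw _ (Nat.le_add_left _ _))
        ((summable_nat_add_iff t₁).2 hws)
    have h3 : ∑' t, w (t + t₁) ≤ C := by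
      rw [hC, ← hws.sum_add_tsum_nat_add t₁]
      have := Finset.sum_nonneg fun t (_ : t ∈ Finset.range t₁) => hw0 t
      linarith
    linarith
  have hq₁ : q t₁ ≤ A / n := by
    refine (hqw t₁ le_rfl).trans ?_
    have ht1 : (1 : ℝ) ≤ t₁ := by linarith
    have h1 := hN₁ t₁ (by omega)
    rw [le_div_iff₀ (by positivity)] at h1
    rw [le_div_iff₀ hnpos]
    calc w t₁ * n ≤ L * (2 * t₁) ^ 2 * Real.exp (-c * (t₁ : ℝ) ^ (2 * δ)) * t₁ := by
          simp only [w]; gcongr; linarith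
      _ = t₁ ^ 3 * Real.exp (-c * (t₁ : ℝ) ^ (2 * δ)) * (4 * L) := by ring
      _ ≤ A := h1
  rw [add_div] at ht₁le
  rw [sub_div] at hlow ht₂ge
  rw [mul_div_assoc]
  refine ⟨t₁, t₂, by linarith, by linarith, ?_⟩
  rw [mul_div_assoc]
  linarith

end Analysis

namespace LineNetwork

/-! ### Assembling the theorem -/

section Main

variable {ℓ : ℕ} {p : Fin ℓ → ℝ}

lemma capacity_le (p : Fin ℓ → ℝ) (i : Fin ℓ) : capacity p ≤ 1 - p i :=
  sub_le_sub_left (le_ciSup (Set.finite_range p).bddAbove i) 1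

lemma exists_capacity_eq (hℓ : 1 ≤ ℓ) (p : Fin ℓ → ℝ) : ∃ j, capacity p = 1 - p j := by
  have : Nonempty (Fin ℓ) := ⟨⟨0, hℓ⟩⟩
  obtain ⟨j, hj⟩ := exists_eq_ciSup_of_finite (f := p)
  exact ⟨j, by rw [capacity, ← hj]⟩

lemma IsErasureProcess.deliveryTail {Ω : Type*} [MeasurableSpace Ω] {μ : Measure Ω}
    [IsProbabilityMeasure μ] {z : ℕ → Fin ℓ → Ω → Bool} (hz : IsErasureProcess μ p z)
    (hℓ : 1 ≤ ℓ) (hA1 : capacity p ≤ 1) (n : ℕ) :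
    DeliveryTail ℓ (capacity p) n fun t => μ.real (undelivered z n t) where
  nonneg _ := measureReal_nonneg
  le_one _ := measureReal_le_one
  antitone _ _ hst := measureReal_mono (undelivered_antitone z n hst)
  upper _ ht := hz.prob_undelivered_le hA1 (capacity_le p) hℓ ht
  lower t ht := by
    obtain ⟨j, hj⟩ := exists_capacity_eq hℓ p
    rw [hj] at ht ⊢
    exact hz.one_sub_prob_undelivered_le j ht

lemma IsErasureProcess.summable_prob_undelivered {Ω : Type*} [MeasurableSpace Ω] {μ : Measure Ω}
    [IsProbabilityMeasure μ] {z : ℕ → Fin ℓ → Ω → Bool} (hz : IsErasureProcess μ p z)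
    (hℓ : 1 ≤ ℓ) (hA0 : 0 < capacity p) (hA1 : capacity p ≤ 1) (n : ℕ) :
    Summable fun t => μ.real (undelivered z n t) := by
  -- Integrability is claimed for every `n`, while the tail estimates need `n > 0`.
  rcases Nat.eq_zero_or_pos n with rfl | hn
  · simp [undelivered]
  · exact (hz.deliveryTail hℓ hA1 n).summable (by exact_mod_cast hℓ) hA0 hA1 hn

lemma IsCoding.setOf_receivedRank_eq {n : ℕ} {Ω K : Type*} [Field K] {z : ℕ → Fin ℓ → Ω → Bool}
    {x : ℕ → Fin ℓ → Ω → Fin n → K} {ω : Ω}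
    (h : IsCoding (fun t i => z t i ω) (fun t i => x t i ω)) :
    {t | receivedRank (fun t i => z t i ω) (fun t i => x t i ω) t = n} =
      {t | ω ∉ undelivered z n t} := by
  ext t
  have := lineRank_le (n := n) (fun t i => z t i ω) t (Fin.last ℓ)
  simp only [Set.mem_ofPred_eq, undelivered, h.receivedRank_eq, not_lt]
  omega

end Main

end LineNetwork

theorem theorem2 (ℓ : ℕ) (hℓ : 1 ≤ ℓ) (p : Fin ℓ → ℝ) (hp0 : ∀ i, 0 ≤ p i)
    (hp1 : ∀ i, p i < 1) (δ : ℝ) (hδ0 : 0 < δ) (hδ1 : δ < 1 / 2) :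
    ∃ N : ℕ, ∀ (n : ℕ) (Ω : Type*) [MeasurableSpace Ω] (μ : Measure Ω) [IsProbabilityMeasure μ]
      (K : Type*) [Field K] (z : ℕ → Fin ℓ → Ω → Bool) (x : ℕ → Fin ℓ → Ω → Fin n → K)
      (T : Ω → ℝ),
      LineNetwork.IsErasureProcess μ p z →
      (∀ᵐ ω ∂μ, LineNetwork.IsCoding (fun t i => z t i ω) (fun t i => x t i ω)) →
      (∀ ω, T ω = LineNetwork.deliveryTime (fun t i => z t i ω) (fun t i => x t i ω)) →
      (∀ᵐ ω ∂μ, ∃ t, LineNetwork.receivedRank (fun t i => z t i ω) (fun t i => x t i ω) t = n) ∧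
      Integrable T μ ∧
      (N ≤ n →
        μ.real {ω | |T ω - ∫ ω', T ω' ∂μ| > (n : ℝ) ^ (1 / 2 + δ) / LineNetwork.capacity p} ≤
          2 * LineNetwork.capacity p / n +
            2 * LineNetwork.capacity p * (n : ℝ) ^ (2 * δ) /
              ((n : ℝ) ^ 2 - (n : ℝ) ^ (1 + 2 * δ))) := by
  have : Nonempty (Fin ℓ) := ⟨⟨0, hℓ⟩⟩
  have hA1 : LineNetwork.capacity p ≤ 1 := by
    have := LineNetwork.capacity_le p ⟨0, hℓ⟩
    have := hp0 ⟨0, hℓ⟩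
    linarith
  have hA0 : 0 < LineNetwork.capacity p := by
    obtain ⟨j, hj⟩ := LineNetwork.exists_capacity_eq hℓ p
    rw [hj]
    exact sub_pos.2 (hp1 j)
  obtain ⟨N, hN⟩ := exists_concentration_of_deliveryTail (L := ℓ) (by exact_mod_cast hℓ) hA0 hA1
    hδ0 hδ1
  refine ⟨max N 1, fun n Ω _ μ _ K _ z x T hz hx hT => ?_⟩
  have hTE : ∀ᵐ ω ∂μ, T ω = (sInf {t | ω ∉ LineNetwork.undelivered z n t} : ℕ) := by
    filter_upwards [hx] with ω hω
    rw [hT, LineNetwork.deliveryTime, hω.setOf_receivedRank_eq]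
  have hanti := LineNetwork.undelivered_antitone z n
  obtain ⟨hfin, hint, hmean⟩ := integrable_and_integral_firstExit
    (hz.measurableSet_undelivered n) hanti (hz.summable_prob_undelivered hℓ hA0 hA1 n) hTE
  refine ⟨?_, hint, fun hn => ?_⟩
  · filter_upwards [hx, hfin] with ω hω ⟨t, ht⟩
    exact ⟨t, (Set.ext_iff.1 hω.setOf_receivedRank_eq t).2 ht⟩
  obtain ⟨t₁, t₂, h₁, h₂, h₃⟩ := hN n ((le_max_left _ _).trans hn) _ (hz.deliveryTail hℓ hA1 n)
  rw [← hmean] at h₁ h₂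
  have hn1 : (1 : ℝ) ≤ n := by exact_mod_cast (le_max_right _ _).trans hn
  have hpow : (n : ℝ) ^ (1 + 2 * δ) ≤ (n : ℝ) ^ 2 := by
    rw [← Real.rpow_natCast]
    exact Real.rpow_le_rpow_of_exponent_le hn1 (by push_cast; linarith)
  have hrest : 0 ≤ 2 * LineNetwork.capacity p * (n : ℝ) ^ (2 * δ) /
      ((n : ℝ) ^ 2 - (n : ℝ) ^ (1 + 2 * δ)) :=
    div_nonneg (by positivity) (sub_nonneg.2 hpow)
  refine le_trans ?_ (h₃.trans (le_add_of_nonneg_right hrest))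
  have hsub : {ω | |T ω - ∫ ω', T ω' ∂μ| > (n : ℝ) ^ (1 / 2 + δ) / LineNetwork.capacity p} ≤ᵐ[μ]
      (LineNetwork.undelivered z n t₁ ∪ (LineNetwork.undelivered z n t₂)ᶜ : Set Ω) := by
    filter_upwards [hTE, hfin] with ω hω hex hdev
    change _ < |T ω - ∫ ω', T ω' ∂μ| at hdev
    rw [hω] at hdev
    rcases lt_abs.1 hdev with h | h
    · left
      have : t₁ < sInf {t | ω ∉ LineNetwork.undelivered z n t} := by
        have : (t₁ : ℝ) < (sInf {t | ω ∉ LineNetwork.undelivered z n t} : ℕ) := by linarith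
        exact_mod_cast this
      by_contra hmem
      exact Nat.notMem_of_lt_sInf this hmem
    · right
      -- The exit time is an integer, so being below `t₂ + 1` means delivery by `t₂`.
      have : sInf {t | ω ∉ LineNetwork.undelivered z n t} ≤ t₂ := by
        have : ((sInf {t | ω ∉ LineNetwork.undelivered z n t} : ℕ) : ℝ) < t₂ + 1 := by linarith
        exact Nat.lt_succ_iff.1 (by exact_mod_cast this)
      exact fun hmem => Nat.sInf_mem hex (hanti this hmem)
  calc _ ≤ μ.real (LineNetwork.undelivered z n t₁ ∪ (LineNetwork.undelivered z n t₂)ᶜ) :=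
        ENNReal.toReal_mono (measure_ne_top _ _) (measure_mono_ae hsub)
    _ ≤ μ.real (LineNetwork.undelivered z n t₁) + μ.real (LineNetwork.undelivered z n t₂)ᶜ :=
        measureReal_union_le _ _
    _ = _ := by rw [probReal_compl_eq_one_sub (hz.measurableSet_undelivered n t₂)]
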